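/- For a domain $D\subset\mathbb C^n$, $z\in D$ and $X\in\mathbb C^n$, the Sibony metric is $$S_D(z;X):=\sup_v\Big[\sum_{j,k=1}^n\frac{\partial^2 v}{\partial z_j\,\partial\bar z_k}(z)\,X_j\overline{X_k}\Big]^{1/2},$$ where the supremum is taken over all functions $v:D\to[0,1)$ such that $v(z)=0$, $\log v$ is plurisubharmonic on $D$ (with $\log 0=-\infty$; the constant $-\infty$ is counted as plurisubharmonic), and $v$ is of class $\mathcal C^2$ near $z$. Let $V^S_D(z)$ be the Lebesgue measure of the indicatrix $\{X\in\mathbb C^n: S_D(z;X)<1\}$. **Proposition 3.** Let $D$ be a bounded domain in $\mathbb C^n$ whose boundary is of class $\mathcal C^1$ near $p\in\partial D$, i.e. there are an open neighbourhood $U$ of $p$ and a $\mathcal C^1$ function $\rho:U\to\mathbb R$ with nowhere vanishing differential such that $D\cap U=\{z\in U:\rho(z)<0\}$. Then $$\lim_{D\ni z\to p}V^S_D(z)=0.$$ -/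

import Mathlib

open MeasureTheory Set Filter Topology
open scoped ENNReal

noncomputable section

/-- The mean value of an extended-real function `g` over `(0, 2π]`: the mean of the positive part
minus the mean of the negative part. For `g` bounded above (as for an upper semicontinuous
function with values in `[-∞, ∞)` on a circle) it is the usual mean value in `[-∞, ∞)`. -/
def angularMean (g : ℝ → EReal) : EReal :=
  ((laverage (volume.restrict (Ioc 0 (2 * Real.pi))) fun t => (g t).toENNReal : ℝ≥0∞) : EReal) -
    ((laverage (volume.restrict (Ioc 0 (2 * Real.pi))) fun t => (-(g t)).toENNReal : ℝ≥0∞) : EReal)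

/-- `u : D → [-∞, ∞)` is plurisubharmonic on the open set `D ⊆ ℂⁿ`: it is upper semicontinuous, and
its restriction to every complex line is subharmonic, that is, it satisfies the sub-mean value
inequality on all sufficiently small circles about each point. Only the values on `D` matter. -/
structure IsPlurisubharmonicOn {n : ℕ} (u : EuclideanSpace ℂ (Fin n) → EReal)
    (D : Set (EuclideanSpace ℂ (Fin n))) : Prop where
  lt_top : ∀ z ∈ D, u z < ⊤
  usc : UpperSemicontinuousOn u D
  submean : ∀ a ∈ D, ∀ b : EuclideanSpace ℂ (Fin n), ∃ R : ℝ, 0 < R ∧ ∀ r : ℝ, 0 < r → r < R →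
    u a ≤ angularMean fun t => u (a + (circleMap 0 r t) • b)

/-- The Wirtinger derivative `∂g/∂z_j = (∂g/∂x_j - i ∂g/∂y_j) / 2`. -/
def dz {n : ℕ} (j : Fin n) (g : EuclideanSpace ℂ (Fin n) → ℂ) (z : EuclideanSpace ℂ (Fin n)) : ℂ :=
  (fderiv ℝ g z (EuclideanSpace.single j 1)
    - Complex.I * fderiv ℝ g z (EuclideanSpace.single j Complex.I)) / 2

/-- The Wirtinger derivative `∂g/∂z̄_k = (∂g/∂x_k + i ∂g/∂y_k) / 2`. -/
def dzbar {n : ℕ} (k : Fin n) (g : EuclideanSpace ℂ (Fin n) → ℂ)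
    (z : EuclideanSpace ℂ (Fin n)) : ℂ :=
  (fderiv ℝ g z (EuclideanSpace.single k 1)
    + Complex.I * fderiv ℝ g z (EuclideanSpace.single k Complex.I)) / 2

/-- The Levi form `∑ⱼ ∑ₖ ∂²v/∂z_j∂z̄_k (z) X_j X̄_k`, a real number when `v` is real and `C²`. -/
def leviForm {n : ℕ} (v : EuclideanSpace ℂ (Fin n) → ℝ) (z X : EuclideanSpace ℂ (Fin n)) : ℝ :=
  (∑ j, ∑ k, dz j (dzbar k fun w => (v w : ℂ)) z * X j * (starRingEnd ℂ) (X k)).re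

/-- The competitors in the definition of the Sibony metric of `D` at `z`: functions
`v : D → [0, 1)` with `v z = 0`, `log v` plurisubharmonic on `D` (with `log 0 = -∞`), and `v` of
class `C²` near `z`. -/
structure IsSibonyCandidate {n : ℕ} (D : Set (EuclideanSpace ℂ (Fin n)))
    (z : EuclideanSpace ℂ (Fin n)) (v : EuclideanSpace ℂ (Fin n) → ℝ) : Prop where
  mapsTo : MapsTo v D (Ico 0 1)
  eq_zero : v z = 0
  log_psh : IsPlurisubharmonicOn (fun w => ENNReal.log (ENNReal.ofReal (v w))) D
  contDiffAt : ContDiffAt ℝ 2 v z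

/-- The Sibony metric `S_D(z; X)`, as a supremum in `[0, ∞]`. -/
def sibonyMetric {n : ℕ} (D : Set (EuclideanSpace ℂ (Fin n)))
    (z X : EuclideanSpace ℂ (Fin n)) : ℝ≥0∞ :=
  ⨆ (v : EuclideanSpace ℂ (Fin n) → ℝ) (_ : IsSibonyCandidate D z v),
    ENNReal.ofReal (Real.sqrt (leviForm v z X))

/-- The indicatrix `{X ∈ ℂⁿ : S_D(z; X) < 1}` of the Sibony metric. -/
def sibonyIndicatrix {n : ℕ} (D : Set (EuclideanSpace ℂ (Fin n)))
    (z : EuclideanSpace ℂ (Fin n)) : Set (EuclideanSpace ℂ (Fin n)) :=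
  {X | sibonyMetric D z X < 1}

/-- The boundary of `D` is of class `C¹` near `p`: in an open neighbourhood `U` of `p`, the set `D`
is given by `ρ < 0` for a `C¹` function `ρ : U → ℝ` with nowhere vanishing differential. -/
def HasC1BoundaryNear {n : ℕ} (D : Set (EuclideanSpace ℂ (Fin n)))
    (p : EuclideanSpace ℂ (Fin n)) : Prop :=
  ∃ (U : Set (EuclideanSpace ℂ (Fin n))) (ρ : EuclideanSpace ℂ (Fin n) → ℝ),
    IsOpen U ∧ p ∈ U ∧ ContDiffOn ℝ 1 ρ U ∧ (∀ z ∈ U, fderiv ℝ ρ z ≠ 0) ∧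
      D ∩ U = {z ∈ U | ρ z < 0}

end

/- A bounded holomorphic map `G` on `D ∩ B(z, τ)` with `G z = 0` and `‖G‖ ≤ M < τ / R` yields a
competitor on all of `D ⊆ B(z, R)`: take `max (‖G‖², (‖w - z‖ / R) ^ c)` inside `B(z, τ)` and the
second function outside. It is log-plurisubharmonic once `M² < (τ / R) ^ c`, and it equals `‖G‖²`
near `z`, hence has Levi form `‖G'(z) X‖²`, because `c > 2` and `‖G‖` dominates a multiple of
`‖w - z‖`. Such a `c` exists as `M < τ / R`.

Write `Re L` for the differential of `ρ` at `p`. By strict differentiability, for every `η > 0`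
and all `z ∈ D` close to `p` there is a scale `τ` such that `Re L (w - z) < η τ` on `D ∩ B(z, τ)`.
Composing `L (w - z)` with the Cayley map `ζ ↦ ζ / (2 η τ - ζ)` of the half plane
`{Re ζ < η τ}` produces a `G` of derivative comparable to `L / η`. So the indicatrix is contained
in a bounded part of the slab `{|L X| < C η}`, whose volume tends to `0` with `η`. -/

open Metric
open scoped InnerProductSpace

section AngularMean

theorem angularMean_mono {g₁ g₂ : ℝ → EReal} (h : g₁ ≤ g₂) : angularMean g₁ ≤ angularMean g₂ :=
  EReal.sub_le_sub
    (EReal.coe_ennreal_le_coe_ennreal_iff.2 <|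
      lintegral_mono fun t => EReal.toENNReal_le_toENNReal (h t))
    (EReal.coe_ennreal_le_coe_ennreal_iff.2 <|
      lintegral_mono fun t => EReal.toENNReal_le_toENNReal (EReal.neg_le_neg_iff.2 (h t)))

theorem angularMean_coe {g : ℝ → ℝ} (hg : IntegrableOn g (Ioc 0 (2 * Real.pi))) :
    angularMean (fun t => (g t : EReal)) = (⨍ t in Ioc 0 (2 * Real.pi), g t : ℝ) := by
  have hint : Integrable g ((volume.restrict (Ioc 0 (2 * Real.pi)) univ)⁻¹ •
      volume.restrict (Ioc 0 (2 * Real.pi))) :=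
    hg.smul_measure (by simp [Real.pi_pos])
  have hneg := hint.neg.lintegral_lt_top
  simp only [Pi.neg_apply] at hneg
  rw [average, integral_eq_lintegral_pos_part_sub_lintegral_neg_part hint, EReal.coe_sub,
    EReal.coe_ennreal_toReal hint.lintegral_lt_top.ne, EReal.coe_ennreal_toReal hneg.ne]
  simp only [angularMean, laverage, ← EReal.coe_neg, EReal.real_coe_toENNReal]

theorem angularMean_circleMap_coe {f : ℂ → ℝ} {c : ℂ} {r : ℝ} (hf : CircleIntegrable f c r) :
    angularMean (fun t => (f (circleMap c r t) : EReal)) = (Real.circleAverage f c r : ℝ) := by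
  rw [angularMean_coe ((intervalIntegrable_iff_integrableOn_Ioc_of_le Real.two_pi_pos.le).1 hf),
    Real.circleAverage_eq_intervalAverage, uIoc_of_le Real.two_pi_pos.le]

end AngularMean

section Submean

theorem monotone_log_ofReal : Monotone fun x : ℝ => ENNReal.log (ENNReal.ofReal x) :=
  ENNReal.log_monotone.comp ENNReal.ofReal_mono

theorem continuous_log_ofReal : Continuous fun x : ℝ => ENNReal.log (ENNReal.ofReal x) :=
  ENNReal.continuous_log.comp ENNReal.continuous_ofReal

variable {E : Type*} [NormedAddCommGroup E] [NormedSpace ℂ E]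

/-- The local sub-mean value inequality for `u` at the single point `a`, along every complex line
through `a`; this is the pointwise content of `IsPlurisubharmonicOn.submean`. -/
def IsSubmeanAt (u : E → EReal) (a : E) : Prop :=
  ∀ b : E, ∃ R : ℝ, 0 < R ∧ ∀ r : ℝ, 0 < r → r < R →
    u a ≤ angularMean fun t => u (a + circleMap 0 r t • b)

theorem exists_pos_forall_circleMap_of_eventually {P : E → Prop} {a : E} (hP : ∀ᶠ w in 𝓝 a, P w)
    (b : E) :
    ∃ R : ℝ, 0 < R ∧ ∀ r : ℝ, 0 < r → r < R → ∀ ζ ∈ closedBall (0 : ℂ) |r|, P (a + ζ • b) := by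
  have hline : Tendsto (fun ζ : ℂ => a + ζ • b) (𝓝 0) (𝓝 a) := by
    simpa using (show Continuous fun ζ : ℂ => a + ζ • b by fun_prop).tendsto 0
  obtain ⟨R, hR, hball⟩ := eventually_nhds_iff_ball.1 (hline.eventually hP)
  exact ⟨R, hR, fun r hr hrR ζ hζ =>
    hball ζ (closedBall_subset_ball (by rwa [abs_of_pos hr]) hζ)⟩

theorem isSubmeanAt_of_eq_bot {u : E → EReal} {a : E} (h : u a = ⊥) : IsSubmeanAt u a :=
  fun _ => ⟨1, one_pos, fun _ _ _ => h ▸ bot_le⟩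

theorem IsSubmeanAt.of_eventuallyLE {u v : E → EReal} {a : E} (hu : IsSubmeanAt u a)
    (hle : u ≤ᶠ[𝓝 a] v) (heq : v a = u a) : IsSubmeanAt v a := fun b => by
  obtain ⟨R₁, hR₁, hmean⟩ := hu b
  obtain ⟨R₂, hR₂, huv⟩ := exists_pos_forall_circleMap_of_eventually hle b
  refine ⟨min R₁ R₂, lt_min hR₁ hR₂, fun r hr hrR => ?_⟩
  calc v a = u a := heq
    _ ≤ angularMean fun t => u (a + circleMap 0 r t • b) :=
        hmean r hr (hrR.trans_le (min_le_left _ _))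
    _ ≤ angularMean fun t => v (a + circleMap 0 r t • b) :=
        angularMean_mono fun t => huv r hr (hrR.trans_le (min_le_right _ _)) _
          (sphere_subset_closedBall (circleMap_mem_sphere' 0 r t))

theorem isSubmeanAt_log_norm_rpow_of_ne_zero {g : E → ℂ} {a : E} (hg : AnalyticAt ℂ g a)
    (ha : g a ≠ 0) (c : ℝ) :
    IsSubmeanAt (fun w => ENNReal.log (ENNReal.ofReal (‖g w‖ ^ c))) a := fun b => by
  obtain ⟨R, hR, hball⟩ := exists_pos_forall_circleMap_of_eventually
    (hg.eventually_analyticAt.and (hg.continuousAt.eventually_ne ha)) b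
  refine ⟨R, hR, fun r hr hrR => ?_⟩
  have hlog : ∀ x : ℂ, x ≠ 0 →
      ENNReal.log (ENNReal.ofReal (‖x‖ ^ c)) = (c * Real.log ‖x‖ : ℝ) := fun x hx => by
    have hx' := norm_pos_iff.2 hx
    rw [ENNReal.log_ofReal_of_pos (by positivity), Real.log_rpow hx']
  have hφ : AnalyticOnNhd ℂ (fun ζ : ℂ => g (a + ζ • b)) (closedBall 0 |r|) := fun ζ hζ =>
    (hball r hr hrR ζ hζ).1.fun_comp (f := fun ζ : ℂ => a + ζ • b) (by fun_prop)
  have hint : CircleIntegrable (fun ζ => Real.log ‖g (a + ζ • b)‖) 0 r :=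
    (hφ.meromorphicOn.mono_set sphere_subset_closedBall).circleIntegrable_log_norm
  refine le_of_eq ?_
  calc ENNReal.log (ENNReal.ofReal (‖g a‖ ^ c))
      = (Real.circleAverage (fun ζ => c * Real.log ‖g (a + ζ • b)‖) 0 r : ℝ) := by
        have havg := hφ.circleAverage_log_norm_of_ne_zero fun ζ hζ => (hball r hr hrR ζ hζ).2
        rw [zero_smul, add_zero] at havg
        rw [hlog _ ha, ← havg, ← smul_eq_mul, ← Real.circleAverage_fun_smul]
        simp only [smul_eq_mul]
    _ = angularMean fun t => (c * Real.log ‖g (a + circleMap 0 r t • b)‖ : ℝ) :=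
        (angularMean_circleMap_coe (hint.const_smul (a := c))).symm
    _ = angularMean fun t => ENNReal.log (ENNReal.ofReal (‖g (a + circleMap 0 r t • b)‖ ^ c)) := by
        congr 1 with t
        exact (hlog _ (hball r hr hrR _
          (sphere_subset_closedBall (circleMap_mem_sphere' 0 r t))).2).symm

/- `‖G‖` is touched from below at `a` by the modulus of the scalar function `⟪G a / ‖G a‖, G ·⟫`. -/
theorem isSubmeanAt_log_norm_rpow {H : Type*} [NormedAddCommGroup H] [InnerProductSpace ℂ H]
    {G : E → H} {a : E} (hG : AnalyticAt ℂ G a) {c : ℝ} (hc : 0 < c) :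
    IsSubmeanAt (fun w => ENNReal.log (ENNReal.ofReal (‖G w‖ ^ c))) a := by
  rcases eq_or_ne (G a) 0 with ha | ha
  · exact isSubmeanAt_of_eq_bot (by simp [ha, Real.zero_rpow hc.ne'])
  set e : H := (‖G a‖ : ℂ)⁻¹ • G a with he
  have he_norm : ‖e‖ = 1 := norm_smul_inv_norm ha
  have hea : ‖⟪e, G a⟫_ℂ‖ = ‖G a‖ := by
    rw [he, inner_smul_left, norm_mul, inner_self_eq_norm_sq_to_K]
    simp [pow_two, ha]
  have hle (w : E) : ‖⟪e, G w⟫_ℂ‖ ≤ ‖G w‖ := by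
    simpa only [he_norm, one_mul] using norm_inner_le_norm (𝕜 := ℂ) e (G w)
  have hg : AnalyticAt ℂ (fun w => ⟪e, G w⟫_ℂ) a := ((innerSL ℂ e).analyticAt (G a)).fun_comp hG
  refine (isSubmeanAt_log_norm_rpow_of_ne_zero hg ?_ c).of_eventuallyLE
    (Eventually.of_forall fun w => monotone_log_ofReal ?_) (by rw [hea])
  · rwa [← norm_ne_zero_iff, hea, norm_ne_zero_iff]
  · exact Real.rpow_le_rpow (norm_nonneg _) (hle w) hc.le

end Submean

section Plurisubharmonic

variable {n : ℕ} {D V : Set (EuclideanSpace ℂ (Fin n))}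

theorem isPlurisubharmonicOn_log_norm_rpow {H : Type*} [NormedAddCommGroup H]
    [InnerProductSpace ℂ H] {G : EuclideanSpace ℂ (Fin n) → H} (hG : AnalyticOnNhd ℂ G D) {c : ℝ}
    (hc : 0 < c) :
    IsPlurisubharmonicOn (fun w => ENNReal.log (ENNReal.ofReal (‖G w‖ ^ c))) D where
  lt_top _ _ := ENNReal.log_lt_top_iff.2 ENNReal.ofReal_lt_top
  usc := (continuous_log_ofReal.comp_continuousOn
    (hG.continuousOn.norm.rpow_const fun _ _ => Or.inr hc.le)).upperSemicontinuousOn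
  submean a ha := isSubmeanAt_log_norm_rpow (hG a ha) hc

theorem upperSemicontinuousOn_glue {α β : Type*} [TopologicalSpace α] [LinearOrder β]
    {D V : Set α} {u u' v : α → β} (hV : IsOpen V) (hu : UpperSemicontinuousOn u D)
    (hu' : UpperSemicontinuousOn u' (D ∩ V))
    (hle : ∀ a ∈ D \ V, ∀ᶠ w in 𝓝[D ∩ V] a, u' w ≤ u w) (hvV : EqOn v (u ⊔ u') V)
    (hvVc : EqOn v u Vᶜ) : UpperSemicontinuousOn v D := fun a ha => by
  by_cases haV : a ∈ V
  · have hnhds : 𝓝[D ∩ V] a = 𝓝[D] a :=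
      nhdsWithin_inter_of_mem' (mem_nhdsWithin_of_mem_nhds (hV.mem_nhds haV))
    have hsup : UpperSemicontinuousWithinAt (u ⊔ u') (D ∩ V) a :=
      UpperSemicontinuousWithinAt.sup ((hu a ha).mono inter_subset_left) (hu' a ⟨ha, haV⟩)
    have hv : UpperSemicontinuousWithinAt v (D ∩ V) a :=
      UpperSemicontinuousWithinAt.congr_of_eventuallyEq hsup ⟨ha, haV⟩
        (eventually_mem_nhdsWithin.mono fun w hw => (hvV hw.2).symm)
    exact fun y hy => hnhds ▸ hv y hy
  · have huv : ∀ᶠ w in 𝓝[D] a, u w = v w := by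
      have hle' := eventually_nhdsWithin_iff.1 (hle a ⟨ha, haV⟩)
      filter_upwards [hle'.filter_mono nhdsWithin_le_nhds, self_mem_nhdsWithin] with w hw hwD
      by_cases hwV : w ∈ V
      · rw [hvV hwV, Pi.sup_apply, sup_eq_left.2 (hw ⟨hwD, hwV⟩)]
      · exact (hvVc hwV).symm
    exact UpperSemicontinuousWithinAt.congr_of_eventuallyEq (hu a ha) ha huv

theorem IsPlurisubharmonicOn.glue {u u' v : EuclideanSpace ℂ (Fin n) → EReal} (hV : IsOpen V)
    (hu : IsPlurisubharmonicOn u D) (hu' : IsPlurisubharmonicOn u' (D ∩ V))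
    (hle : ∀ a ∈ D \ V, ∀ᶠ w in 𝓝[D ∩ V] a, u' w ≤ u w) (hvV : EqOn v (u ⊔ u') V)
    (hvVc : EqOn v u Vᶜ) : IsPlurisubharmonicOn v D where
  lt_top a ha := by
    by_cases haV : a ∈ V
    · exact hvV haV ▸ max_lt (hu.lt_top a ha) (hu'.lt_top a ⟨ha, haV⟩)
    · exact hvVc haV ▸ hu.lt_top a ha
  usc := upperSemicontinuousOn_glue hV hu.usc hu'.usc hle hvV hvVc
  submean a ha := by
    have huv : u ≤ v := fun w => by
      by_cases hw : w ∈ V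
      · exact le_sup_left.trans_eq (hvV hw).symm
      · exact (hvVc hw).ge
    have hu'v : ∀ w ∈ V, u' w ≤ v w := fun w hw => le_sup_right.trans_eq (hvV hw).symm
    have of_eq_u (h : v a = u a) : IsSubmeanAt v a :=
      IsSubmeanAt.of_eventuallyLE (hu.submean a ha) (Eventually.of_forall huv) h
    by_cases haV : a ∈ V
    · rcases max_choice (u a) (u' a) with h | h
      · exact of_eq_u ((hvV haV).trans h)
      · exact IsSubmeanAt.of_eventuallyLE (hu'.submean a ⟨ha, haV⟩)
          (eventually_of_mem (hV.mem_nhds haV) hu'v) ((hvV haV).trans h)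
    · exact of_eq_u (hvVc haV)

theorem isPlurisubharmonicOn_log_max_indicator {g h : EuclideanSpace ℂ (Fin n) → ℝ}
    (hV : IsOpen V) (hg0 : 0 ≤ g)
    (hg : IsPlurisubharmonicOn (fun w => ENNReal.log (ENNReal.ofReal (g w))) D)
    (hh : IsPlurisubharmonicOn (fun w => ENNReal.log (ENNReal.ofReal (h w))) (D ∩ V))
    (hle : ∀ a ∈ D \ V, ∀ᶠ w in 𝓝[D ∩ V] a, h w ≤ g w) :
    IsPlurisubharmonicOn
      (fun w => ENNReal.log (ENNReal.ofReal (max (g w) (V.indicator h w)))) D := by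
  refine hg.glue hV hh (fun a ha => (hle a ha).mono fun w hw => monotone_log_ofReal hw)
    (fun w hw => ?_) fun w hw => ?_
  · simp only [indicator_of_mem hw]
    exact monotone_log_ofReal.map_max
  · rw [indicator_of_notMem hw, max_eq_left]
    exact hg0 w

end Plurisubharmonic

section LeviForm

variable {n : ℕ} {H : Type*} [NormedAddCommGroup H] [InnerProductSpace ℂ H]
  {z : EuclideanSpace ℂ (Fin n)}

theorem ofReal_norm_sq_eq_inner (x : H) : ((‖x‖ ^ 2 : ℝ) : ℂ) = ⟪x, x⟫_ℂ := by
  simp [inner_self_eq_norm_sq_to_K]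

theorem fderiv_inner_complex_apply {F G : EuclideanSpace ℂ (Fin n) → H}
    (hF : DifferentiableAt ℂ F z) (hG : DifferentiableAt ℂ G z) (X : EuclideanSpace ℂ (Fin n)) :
    fderiv ℝ (fun w => ⟪F w, G w⟫_ℂ) z X =
      ⟪F z, fderiv ℂ G z X⟫_ℂ + ⟪fderiv ℂ F z X, G z⟫_ℂ := by
  rw [fderiv_inner_apply ℂ (hF.restrictScalars ℝ) (hG.restrictScalars ℝ),
    hF.fderiv_restrictScalars ℝ, hG.fderiv_restrictScalars ℝ]
  rfl

theorem single_I_eq_smul (j : Fin n) :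
    EuclideanSpace.single j Complex.I = Complex.I • EuclideanSpace.single j (1 : ℂ) := by
  ext i; simp

theorem dz_inner {F G : EuclideanSpace ℂ (Fin n) → H} (hF : DifferentiableAt ℂ F z)
    (hG : DifferentiableAt ℂ G z) (j : Fin n) :
    dz j (fun w => ⟪F w, G w⟫_ℂ) z = ⟪F z, fderiv ℂ G z (EuclideanSpace.single j 1)⟫_ℂ := by
  simp only [dz, fderiv_inner_complex_apply hF hG, single_I_eq_smul, map_smul, inner_smul_left,
    inner_smul_right, Complex.conj_I]
  linear_combination (-⟪F z, fderiv ℂ G z (EuclideanSpace.single j 1)⟫_ℂ +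
    ⟪fderiv ℂ F z (EuclideanSpace.single j 1), G z⟫_ℂ) / 2 * Complex.I_sq

theorem dzbar_inner {F G : EuclideanSpace ℂ (Fin n) → H} (hF : DifferentiableAt ℂ F z)
    (hG : DifferentiableAt ℂ G z) (k : Fin n) :
    dzbar k (fun w => ⟪F w, G w⟫_ℂ) z = ⟪fderiv ℂ F z (EuclideanSpace.single k 1), G z⟫_ℂ := by
  simp only [dzbar, fderiv_inner_complex_apply hF hG, single_I_eq_smul, map_smul, inner_smul_left,
    inner_smul_right, Complex.conj_I]
  linear_combination (⟪F z, fderiv ℂ G z (EuclideanSpace.single k 1)⟫_ℂ -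
    ⟪fderiv ℂ F z (EuclideanSpace.single k 1), G z⟫_ℂ) / 2 * Complex.I_sq

theorem dz_congr {f g : EuclideanSpace ℂ (Fin n) → ℂ} (h : f =ᶠ[𝓝 z] g) (j : Fin n) :
    dz j f z = dz j g z := by
  simp only [dz, h.fderiv_eq]

theorem dzbar_congr {f g : EuclideanSpace ℂ (Fin n) → ℂ} (h : f =ᶠ[𝓝 z] g) (k : Fin n) :
    dzbar k f z = dzbar k g z := by
  simp only [dzbar, h.fderiv_eq]

theorem leviForm_of_eventuallyEq_norm_sq [CompleteSpace H] {v : EuclideanSpace ℂ (Fin n) → ℝ}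
    {G : EuclideanSpace ℂ (Fin n) → H} (hG : AnalyticAt ℂ G z)
    (hv : v =ᶠ[𝓝 z] fun w => ‖G w‖ ^ 2) (X : EuclideanSpace ℂ (Fin n)) :
    leviForm v z X = ‖fderiv ℂ G z X‖ ^ 2 := by
  have hdzbar (k : Fin n) : dzbar k (fun w => (v w : ℂ)) =ᶠ[𝓝 z]
      fun w => ⟪fderiv ℂ G w (EuclideanSpace.single k 1), G w⟫_ℂ := by
    filter_upwards [hv.eventuallyEq_nhds, hG.eventually_analyticAt] with w hvw hGw
    rw [← dzbar_inner hGw.differentiableAt hGw.differentiableAt]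
    refine dzbar_congr (hvw.mono fun x hx => ?_) k
    rw [hx, ofReal_norm_sq_eq_inner]
  have hmixed (j k : Fin n) : dz j (dzbar k fun w => (v w : ℂ)) z =
      ⟪fderiv ℂ G z (EuclideanSpace.single k 1), fderiv ℂ G z (EuclideanSpace.single j 1)⟫_ℂ := by
    rw [dz_congr (hdzbar k), dz_inner _ hG.differentiableAt]
    exact hG.fderiv.differentiableAt.clm_apply (differentiableAt_const _)
  have hX : fderiv ℂ G z X = ∑ j, X j • fderiv ℂ G z (EuclideanSpace.single j 1) := by
    conv_lhs => rw [← (EuclideanSpace.basisFun (Fin n) ℂ).sum_repr X]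
    simp
  have hsum : ((‖fderiv ℂ G z X‖ ^ 2 : ℝ) : ℂ) =
      ∑ j, ∑ k, dz j (dzbar k fun w => (v w : ℂ)) z * X j * (starRingEnd ℂ) (X k) := by
    rw [ofReal_norm_sq_eq_inner, hX]
    simp only [hmixed, sum_inner, inner_sum, inner_smul_left, inner_smul_right,
      Finset.mul_sum]
    exact Finset.sum_congr rfl fun j _ => Finset.sum_congr rfl fun k _ => by ring
  rw [leviForm, ← hsum, Complex.ofReal_re]

end LeviForm

section Candidate

variable {n : ℕ} {D : Set (EuclideanSpace ℂ (Fin n))} {z : EuclideanSpace ℂ (Fin n)}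

theorem exists_two_lt_sq_lt_rpow {M x : ℝ} (hM : 0 ≤ M) (hMx : M < x) :
    ∃ c : ℝ, 2 < c ∧ M ^ 2 < x ^ c := by
  have hcont : ContinuousAt (fun c : ℝ => x ^ c) 2 :=
    Real.continuousAt_const_rpow (hM.trans_lt hMx).ne'
  have hsq : M ^ 2 < x ^ (2 : ℝ) := by
    rw [Real.rpow_two]
    gcongr
  obtain ⟨c, hc, hc2⟩ := (((hcont.eventually (lt_mem_nhds hsq)).filter_mono
    nhdsWithin_le_nhds).and (self_mem_nhdsWithin (s := Ioi (2 : ℝ)))).exists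
  exact ⟨c, hc2, hc⟩

theorem isLittleO_norm_rpow_norm_sq {E : Type*} [SeminormedAddCommGroup E] {c : ℝ} (hc : 2 < c) :
    (fun x : E => ‖x‖ ^ c) =o[𝓝 0] fun x => ‖x‖ ^ 2 := by
  have htendsto : Tendsto (fun x : E => ‖x‖ ^ (c - 2)) (𝓝 0) (𝓝 0) := by
    have hcont : Continuous fun x : E => ‖x‖ ^ (c - 2) :=
      continuous_norm.rpow_const fun _ => Or.inr (by linarith)
    simpa [Real.zero_rpow (sub_pos.2 hc).ne'] using hcont.tendsto 0
  refine (((Asymptotics.isLittleO_one_iff ℝ).2 htendsto).mul_isBigO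
    (Asymptotics.isBigO_refl (fun x : E => ‖x‖ ^ 2) (𝓝 0))).congr (fun x => ?_) fun x => one_mul _
  rw [← Real.rpow_two, ← Real.rpow_add_of_nonneg (norm_nonneg x) (by linarith) zero_le_two,
    sub_add_cancel]

variable {H : Type*} [NormedAddCommGroup H]
  {G : EuclideanSpace ℂ (Fin n) → H} {R τ M : ℝ}

/-- The function `max (‖(w - z) / R‖ ^ c) ‖G w‖²`, where the second term only counts on the ball of
radius `τ` about `z`. For `c > 2` it extends `‖G‖²` from a neighbourhood of `z` to a competitor for
the Sibony metric of a domain contained in the ball of radius `R` about `z`. -/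
noncomputable def gluedCompetitor (z : EuclideanSpace ℂ (Fin n)) (R τ c : ℝ)
    (G : EuclideanSpace ℂ (Fin n) → H) (w : EuclideanSpace ℂ (Fin n)) : ℝ :=
  max (‖R⁻¹ • (w - z)‖ ^ c) ((ball z τ).indicator (fun w => ‖G w‖ ^ 2) w)

theorem gluedCompetitor_eventuallyEq (hτ : 0 < τ) {c : ℝ} (hc : 2 < c)
    (hGz : (fun w => w - z) =O[𝓝 z] G) :
    gluedCompetitor z R τ c G =ᶠ[𝓝 z] fun w => ‖G w‖ ^ 2 := by
  have hsub : Tendsto (fun w => R⁻¹ • (w - z)) (𝓝 z) (𝓝 0) := by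
    simpa using (show Continuous fun w => R⁻¹ • (w - z) by fun_prop).tendsto z
  have hO : (fun w => R⁻¹ • (w - z)) =O[𝓝 z] G := by
    simpa only [Pi.smul_def] using hGz.const_smul_left R⁻¹
  have hlittle : (fun w => ‖R⁻¹ • (w - z)‖ ^ c) =o[𝓝 z] fun w => ‖G w‖ ^ 2 :=
    ((isLittleO_norm_rpow_norm_sq hc).comp_tendsto hsub).trans_isBigO (hO.norm_norm.pow 2)
  filter_upwards [hlittle.bound one_pos, ball_mem_nhds z hτ] with w hw hwτ
  rw [gluedCompetitor, indicator_of_mem hwτ, max_eq_right]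
  simpa using (le_abs_self _).trans hw

variable [InnerProductSpace ℂ H]

theorem isPlurisubharmonicOn_log_gluedCompetitor {c : ℝ} (hR : 0 < R) (hτ : 0 < τ) (hc : 0 < c)
    (hG : AnalyticOnNhd ℂ G (D ∩ ball z τ)) (hGM : ∀ w ∈ D ∩ ball z τ, ‖G w‖ ≤ M)
    (hMc : M ^ 2 < (τ / R) ^ c) :
    IsPlurisubharmonicOn
      (fun w => ENNReal.log (ENNReal.ofReal (gluedCompetitor z R τ c G w))) D := by
  have hpow : IsPlurisubharmonicOn
      (fun w => ENNReal.log (ENNReal.ofReal (‖R⁻¹ • (w - z)‖ ^ c))) D :=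
    isPlurisubharmonicOn_log_norm_rpow (fun w _ => by fun_prop) hc
  have hsq : IsPlurisubharmonicOn
      (fun w => ENNReal.log (ENNReal.ofReal (‖G w‖ ^ 2))) (D ∩ ball z τ) := by
    simpa only [Real.rpow_two] using isPlurisubharmonicOn_log_norm_rpow hG two_pos
  refine isPlurisubharmonicOn_log_max_indicator isOpen_ball (fun w => by positivity) hpow hsq ?_
  intro a ha
  have hcont : Continuous fun w => ‖R⁻¹ • (w - z)‖ ^ c :=
    (by fun_prop : Continuous fun w => ‖R⁻¹ • (w - z)‖).rpow_const fun _ => Or.inr hc.le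
  have hMa : M ^ 2 < ‖R⁻¹ • (a - z)‖ ^ c := by
    have hτa : τ ≤ ‖a - z‖ := by simpa [dist_eq_norm] using ha.2
    rw [norm_smul, norm_inv, Real.norm_of_nonneg hR.le, inv_mul_eq_div]
    exact hMc.trans_le (by gcongr)
  filter_upwards [self_mem_nhdsWithin,
    nhdsWithin_le_nhds (hcont.continuousAt.eventually (lt_mem_nhds hMa))] with w hw hMw
  calc ‖G w‖ ^ 2 ≤ M ^ 2 := by gcongr; exact hGM w hw
    _ ≤ ‖R⁻¹ • (w - z)‖ ^ c := hMw.le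

theorem exists_isSibonyCandidate_leviForm_eq [CompleteSpace H] (hz : z ∈ D) (hDR : D ⊆ ball z R)
    (hτ : 0 < τ) (hτR : τ ≤ R) (hG : AnalyticOnNhd ℂ G (D ∩ ball z τ)) (hG0 : G z = 0)
    (hGz : (fun w => w - z) =O[𝓝 z] G) (hGM : ∀ w ∈ D ∩ ball z τ, ‖G w‖ ≤ M)
    (hM : M < τ / R) :
    ∃ v, IsSibonyCandidate D z v ∧ ∀ X, leviForm v z X = ‖fderiv ℂ G z X‖ ^ 2 := by
  have hR : 0 < R := hτ.trans_le hτR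
  have hzτ : z ∈ D ∩ ball z τ := ⟨hz, mem_ball_self hτ⟩
  have hM0 : 0 ≤ M := (norm_nonneg _).trans (hGM z hzτ)
  have hM1 : M < 1 := hM.trans_le ((div_le_one hR).2 hτR)
  obtain ⟨c, hc, hMc⟩ := exists_two_lt_sq_lt_rpow hM0 hM
  have hc0 : 0 < c := two_pos.trans hc
  have hnear := gluedCompetitor_eventuallyEq (R := R) hτ hc hGz
  refine ⟨gluedCompetitor z R τ c G, ⟨fun w hw => ⟨?_, ?_⟩, ?_, ?_, ?_⟩, fun X =>
    leviForm_of_eventuallyEq_norm_sq (hG z hzτ) hnear X⟩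
  · exact le_max_of_le_left (by positivity)
  · refine max_lt (Real.rpow_lt_one (norm_nonneg _) ?_ hc0) ?_
    · rw [norm_smul, norm_inv, Real.norm_of_nonneg hR.le, inv_mul_lt_one₀ hR]
      exact mem_ball_iff_norm.1 (hDR hw)
    · by_cases hwτ : w ∈ ball z τ
      · rw [indicator_of_mem hwτ]
        exact pow_lt_one₀ (norm_nonneg _) ((hGM w ⟨hw, hwτ⟩).trans_lt hM1) two_ne_zero
      · rw [indicator_of_notMem hwτ]
        exact one_pos
  · simp [hnear.self_of_nhds, hG0]
  · exact isPlurisubharmonicOn_log_gluedCompetitor hR hτ hc0 hG hGM hMc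
  · exact (((hG z hzτ).contDiffAt.restrict_scalars ℝ).norm_sq ℂ).congr_of_eventuallyEq hnear

end Candidate

section WeightedPair

variable {E : Type*} [NormedAddCommGroup E] [InnerProductSpace ℂ E] {r τ : ℝ}

variable (E r τ) in
/-- The linear map `(x, y) ↦ (τ x, y) / r` into the Hilbert sum `ℂ ⊕ E`. Applied to
`(F w, w - z)` for a holomorphic function `F` vanishing at `z`, it gives a holomorphic map whose
squared norm is comparable to `‖w - z‖²` near `z` and sees the derivative of `F` at `z`. -/
noncomputable def weightedPair : ℂ × E →L[ℂ] WithLp 2 (ℂ × E) :=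
  (r : ℂ)⁻¹ • (WithLp.prodContinuousLinearEquiv 2 ℂ ℂ E).symm.toContinuousLinearMap ∘L
    ((τ : ℂ) • ContinuousLinearMap.fst ℂ ℂ E).prod (ContinuousLinearMap.snd ℂ ℂ E)

theorem norm_sq_weightedPair (x : ℂ) (y : E) :
    ‖weightedPair E r τ (x, y)‖ ^ 2 = ((τ * ‖x‖) ^ 2 + ‖y‖ ^ 2) / r ^ 2 := by
  simp [weightedPair, norm_smul, mul_pow, WithLp.prod_norm_sq_eq_of_L2, div_eq_inv_mul]

theorem norm_le_mul_norm_weightedPair (hr : 0 < r) (x : ℂ) (y : E) :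
    ‖y‖ ≤ r * ‖weightedPair E r τ (x, y)‖ := by
  refine (sq_le_sq₀ (norm_nonneg _) (by positivity)).1 ?_
  rw [mul_pow, norm_sq_weightedPair, mul_div_cancel₀ _ (by positivity)]
  exact le_add_of_nonneg_left (sq_nonneg _)

theorem norm_weightedPair_le (hr : 0 < r) (hτ : 0 ≤ τ) {x : ℂ} {y : E} (hx : ‖x‖ ≤ 1)
    (hy : ‖y‖ ≤ τ) : ‖weightedPair E r τ (x, y)‖ ≤ 2 * τ / r := by
  refine (sq_le_sq₀ (norm_nonneg _) (by positivity)).1 ?_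
  rw [norm_sq_weightedPair, div_pow]
  have hx' : (τ * ‖x‖) ^ 2 ≤ τ ^ 2 := by
    gcongr
    exact mul_le_of_le_one_right hτ hx
  have hy' : ‖y‖ ^ 2 ≤ τ ^ 2 := by gcongr
  gcongr
  linarith [sq_nonneg τ]

end WeightedPair

section Indicatrix

variable {n : ℕ} {D : Set (EuclideanSpace ℂ (Fin n))} {z : EuclideanSpace ℂ (Fin n)} {R τ : ℝ}

theorem leviForm_lt_one_of_mem_sibonyIndicatrix {v : EuclideanSpace ℂ (Fin n) → ℝ}
    {X : EuclideanSpace ℂ (Fin n)} (hv : IsSibonyCandidate D z v)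
    (hX : X ∈ sibonyIndicatrix D z) : leviForm v z X < 1 := by
  have hle : ENNReal.ofReal (Real.sqrt (leviForm v z X)) ≤ sibonyMetric D z X :=
    le_iSup₂ (f := fun v (_ : IsSibonyCandidate D z v) =>
      ENNReal.ofReal (Real.sqrt (leviForm v z X))) v hv
  have hlt := ENNReal.ofReal_lt_one.1 (hle.trans_lt hX)
  simpa using (Real.sqrt_lt' one_pos).1 hlt

theorem sibonyIndicatrix_subset_of_analyticOnNhd (hz : z ∈ D) (hDR : D ⊆ ball z R) (hτ : 0 < τ)
    (hτR : τ ≤ R) {F : EuclideanSpace ℂ (Fin n) → ℂ} (hF : AnalyticOnNhd ℂ F (D ∩ ball z τ))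
    (hF0 : F z = 0) (hF1 : ∀ w ∈ D ∩ ball z τ, ‖F w‖ ≤ 1) :
    sibonyIndicatrix D z ⊆ {X | ‖X‖ < 3 * R ∧ τ * ‖fderiv ℂ F z X‖ < 3 * R} := fun X hX => by
  have hR : 0 < R := hτ.trans_le hτR
  let T := weightedPair (EuclideanSpace ℂ (Fin n)) (3 * R) τ
  let G : EuclideanSpace ℂ (Fin n) → WithLp 2 (ℂ × EuclideanSpace ℂ (Fin n)) :=
    fun w => T (F w, w - z)
  have hG : AnalyticOnNhd ℂ G (D ∩ ball z τ) := fun w hw =>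
    (T.analyticAt _).fun_comp ((hF w hw).prod (by fun_prop))
  have hG0 : G z = 0 := by
    simp only [G, hF0, sub_self]
    exact map_zero T
  have hG' : fderiv ℂ G z X = T (fderiv ℂ F z X, X) := by
    have hFz := (hF z ⟨hz, mem_ball_self hτ⟩).differentiableAt.hasFDerivAt
    have := T.hasFDerivAt.comp z (hFz.prodMk ((hasFDerivAt_id z).sub_const z))
    exact DFunLike.congr_fun this.fderiv X
  have hGz : (fun w => w - z) =O[𝓝 z] G :=
    Asymptotics.IsBigO.of_bound (3 * R) <| Eventually.of_forall fun w =>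
      norm_le_mul_norm_weightedPair (by positivity) (F w) (w - z)
  have hGM : ∀ w ∈ D ∩ ball z τ, ‖G w‖ ≤ 2 * τ / (3 * R) := fun w hw =>
    norm_weightedPair_le (by positivity) hτ.le (hF1 w hw) (mem_ball_iff_norm.1 hw.2).le
  have hM : 2 * τ / (3 * R) < τ / R := by
    rw [div_lt_div_iff₀ (by positivity) hR]
    nlinarith [mul_pos hτ hR]
  obtain ⟨v, hv, hlevi⟩ := exists_isSibonyCandidate_leviForm_eq hz hDR hτ hτR hG hG0 hGz hGM hM
  have hlt := leviForm_lt_one_of_mem_sibonyIndicatrix hv hX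
  rw [hlevi, hG', norm_sq_weightedPair, div_lt_one (by positivity)] at hlt
  constructor <;> refine lt_of_pow_lt_pow_left₀ 2 (by positivity) ?_
  · nlinarith [mul_nonneg (sq_nonneg τ) (sq_nonneg ‖fderiv ℂ F z X‖)]
  · nlinarith [sq_nonneg ‖X‖]

theorem two_mul_sub_ne_zero {s : ℝ} {ζ : ℂ} (hs : 0 < s) (hζ : ζ.re ≤ s) : 2 * s - ζ ≠ 0 := by
  intro h
  have hre : 2 * s - ζ.re = 0 := by simpa using congrArg Complex.re h
  linarith

theorem norm_div_two_mul_sub_le_one {s : ℝ} {ζ : ℂ} (hs : 0 ≤ s) (hζ : ζ.re ≤ s) :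
    ‖ζ / (2 * s - ζ)‖ ≤ 1 := by
  have hre : (2 * s - ζ).re = 2 * s - ζ.re := by simp
  have him : (2 * s - ζ).im = -ζ.im := by simp
  rw [norm_div]
  refine div_le_one_of_le₀ ((sq_le_sq₀ (norm_nonneg _) (norm_nonneg _)).1 ?_) (norm_nonneg _)
  rw [Complex.sq_norm, Complex.sq_norm, Complex.normSq_apply, Complex.normSq_apply, hre, him]
  nlinarith

theorem hasDerivAt_div_two_mul_sub {s : ℂ} (hs : s ≠ 0) :
    HasDerivAt (fun ζ : ℂ => ζ / (2 * s - ζ)) (2 * s)⁻¹ 0 := by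
  have := (hasDerivAt_id (0 : ℂ)).fun_div ((hasDerivAt_id (0 : ℂ)).const_sub (2 * s)) (by simpa)
  convert! this using 1
  simp only [id_eq, sub_zero, one_mul, zero_mul]
  field_simp

theorem sibonyIndicatrix_subset_slab (hz : z ∈ D) (hDR : D ⊆ ball z R) (hτ : 0 < τ) (hτR : τ ≤ R)
    (L : EuclideanSpace ℂ (Fin n) →L[ℂ] ℂ) {η : ℝ} (hη : 0 < η)
    (hL : ∀ w ∈ D ∩ ball z τ, (L (w - z)).re ≤ η * τ) :
    sibonyIndicatrix D z ⊆ ball 0 (3 * R) ∩ L ⁻¹' ball 0 (6 * R * η) := fun X hX => by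
  obtain ⟨s, hs_def⟩ : ∃ s, s = η * τ := ⟨_, rfl⟩
  rw [← hs_def] at hL
  have hs : 0 < s := hs_def ▸ mul_pos hη hτ
  let F : EuclideanSpace ℂ (Fin n) → ℂ := fun w => L (w - z) / (2 * s - L (w - z))
  have hF : AnalyticOnNhd ℂ F (D ∩ ball z τ) := fun w hw => by
    have hLw : AnalyticAt ℂ (fun w => L (w - z)) w := (L.analyticAt _).fun_comp (by fun_prop)
    exact hLw.div (analyticAt_const.sub hLw) (two_mul_sub_ne_zero hs (hL w hw))
  have hF' : fderiv ℂ F z X = (2 * s : ℂ)⁻¹ * L X := by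
    have hLz : HasFDerivAt (fun w => L (w - z)) L z :=
      L.hasFDerivAt.comp z ((hasFDerivAt_id z).sub_const z)
    have hcayley : HasDerivAt (fun ζ : ℂ => ζ / (2 * s - ζ)) (2 * s : ℂ)⁻¹ (L (z - z)) := by
      rw [sub_self, map_zero]
      exact hasDerivAt_div_two_mul_sub (by exact_mod_cast hs.ne')
    exact DFunLike.congr_fun (hcayley.comp_hasFDerivAt z hLz).fderiv X
  obtain ⟨hX_norm, hX_fderiv⟩ := sibonyIndicatrix_subset_of_analyticOnNhd hz hDR hτ hτR hF
    (by simp [F]) (fun w hw => norm_div_two_mul_sub_le_one hs.le (hL w hw)) hX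
  have hnorm : τ * ‖fderiv ℂ F z X‖ = ‖L X‖ / (2 * η) := by
    rw [hF', norm_mul, norm_inv, norm_mul, Complex.norm_ofNat, Complex.norm_of_nonneg hs.le, hs_def]
    field_simp
  rw [hnorm, div_lt_iff₀ (by positivity)] at hX_fderiv
  refine ⟨mem_ball_zero_iff.2 hX_norm, mem_ball_zero_iff.2 (hX_fderiv.trans_eq ?_)⟩
  ring

end Indicatrix

section Slab

theorem tendsto_addHaar_ball_inter_preimage_ball {E F : Type*} [NormedAddCommGroup E]
    [NormedSpace ℝ E] [FiniteDimensional ℝ E] [MeasurableSpace E] [BorelSpace E]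
    [NormedAddCommGroup F] [NormedSpace ℝ F] (μ : Measure E) [μ.IsAddHaarMeasure]
    {L : E →L[ℝ] F} (hL : L ≠ 0) (r : ℝ) :
    Tendsto (fun η => μ (ball 0 r ∩ L ⁻¹' ball 0 η)) (𝓝[>] 0) (𝓝 0) := by
  have hinter : ⋂ η > (0 : ℝ), ball 0 r ∩ L ⁻¹' ball 0 η ⊆ LinearMap.ker L.toLinearMap :=
    fun X hX => by
    have hmem : L X ∈ ⋂ η > (0 : ℝ), ball (0 : F) η :=
      mem_iInter₂.2 fun η hη => (mem_iInter₂.1 hX η hη).2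
    simpa [biInter_gt_ball] using hmem
  have hker : LinearMap.ker L.toLinearMap ≠ ⊤ := by
    rw [Ne, LinearMap.ker_eq_top]
    exact_mod_cast hL
  rw [← measure_mono_null hinter (Measure.addHaar_submodule μ _ hker)]
  refine tendsto_measure_biInter_gt (fun η _ => ?_) (fun η η' _ h => ?_) ⟨1, one_pos, ?_⟩
  · exact (isOpen_ball.inter (isOpen_ball.preimage L.continuous)).measurableSet.nullMeasurableSet
  · exact inter_subset_inter_right _ (preimage_mono (ball_subset_ball h))
  · exact ((measure_mono inter_subset_left).trans_lt measure_ball_lt_top).ne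

end Slab

section Boundary

theorem eventually_exists_forall_fderiv_sub_lt {E : Type*} [NormedAddCommGroup E]
    [NormedSpace ℝ E] {D : Set E} {p : E} {ρ : E → ℝ} {ρ' : E →L[ℝ] ℝ}
    (hρ : HasStrictFDerivAt ρ ρ' p) (hρp : ρ p = 0) (hD : ∀ᶠ z in 𝓝[D] p, ρ z < 0) {η R : ℝ}
    (hη : 0 < η) (hR : 0 < R) :
    ∀ᶠ z in 𝓝[D] p, ∃ τ, 0 < τ ∧ τ ≤ R ∧ ∀ w ∈ D ∩ ball z τ, ρ' (w - z) < η * τ := by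
  obtain ⟨s, hs, happrox⟩ :=
    hρ.approximates_deriv_on_nhds (c := ⟨η / 2, (half_pos hη).le⟩) (Or.inr (half_pos hη))
  obtain ⟨r, hr, hball⟩ := Metric.mem_nhds_iff.1 (inter_mem hs (eventually_nhdsWithin_iff.1 hD))
  have hτ : Tendsto (fun z => -ρ z / (η / 2)) (𝓝[D] p) (𝓝 0) := by
    have := (hρ.hasFDerivAt.continuousAt.tendsto.neg.div_const (η / 2)).mono_left
      (nhdsWithin_le_nhds (s := D))
    simpa only [hρp, neg_zero, zero_div] using this
  filter_upwards [hD, hτ.eventually (gt_mem_nhds (lt_min (half_pos hr) hR)),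
    nhdsWithin_le_nhds (ball_mem_nhds p (half_pos hr))] with z hz hzτ hzp
  obtain ⟨hzr, hzR⟩ := lt_min_iff.1 hzτ
  refine ⟨-ρ z / (η / 2), div_pos (neg_pos.2 hz) (half_pos hη), hzR.le, fun w ⟨hwD, hwz⟩ => ?_⟩
  have hwp : w ∈ ball p r := mem_ball.2 <|
    (dist_triangle w z p).trans_lt ((add_lt_add (hwz.trans hzr) hzp).trans_eq (add_halves r))
  have hρw : ρ w < 0 := (hball hwp).2 hwD
  have hle : ‖ρ w - ρ z - ρ' (w - z)‖ ≤ η / 2 * ‖w - z‖ :=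
    happrox w (hball hwp).1 z (hball (ball_subset_ball (half_le_self hr.le) hzp)).1
  have hwz' : η / 2 * ‖w - z‖ < -ρ z := by
    rw [← lt_div_iff₀' (half_pos hη)]
    exact mem_ball_iff_norm.1 hwz
  have hητ : η * (-ρ z / (η / 2)) = 2 * -ρ z := by field_simp
  linarith [neg_le_of_abs_le hle]

theorem HasC1BoundaryNear.exists_hasStrictFDerivAt {n : ℕ} {D : Set (EuclideanSpace ℂ (Fin n))}
    {p : EuclideanSpace ℂ (Fin n)} (h : HasC1BoundaryNear D p) (hp : p ∈ frontier D) :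
    ∃ (ρ : EuclideanSpace ℂ (Fin n) → ℝ) (ρ' : EuclideanSpace ℂ (Fin n) →L[ℝ] ℝ),
      HasStrictFDerivAt ρ ρ' p ∧ ρ' ≠ 0 ∧ ρ p = 0 ∧ ∀ᶠ z in 𝓝[D] p, ρ z < 0 := by
  obtain ⟨U, ρ, hU, hpU, hρ, hdρ, hDU⟩ := h
  have hstrict : HasStrictFDerivAt ρ (fderiv ℝ ρ p) p :=
    (hρ.contDiffAt (hU.mem_nhds hpU)).hasStrictFDerivAt one_ne_zero
  have hcont : ContinuousAt ρ p := hstrict.hasFDerivAt.continuousAt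
  have hneg : ∀ᶠ z in 𝓝[D] p, ρ z < 0 := by
    filter_upwards [self_mem_nhdsWithin, nhdsWithin_le_nhds (hU.mem_nhds hpU)] with z hzD hzU
    exact (hDU.subset ⟨hzD, hzU⟩).2
  have hle : ρ p ≤ 0 := by
    have := mem_closure_iff_nhdsWithin_neBot.1 hp.1
    exact le_of_tendsto (hcont.tendsto.mono_left nhdsWithin_le_nhds) (hneg.mono fun _ => le_of_lt)
  have hge : 0 ≤ ρ p := by
    by_contra! hlt
    refine hp.2 (mem_interior_iff_mem_nhds.2 ?_)
    filter_upwards [hcont.eventually (gt_mem_nhds hlt), hU.mem_nhds hpU] with z hz hzU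
    exact (hDU.superset ⟨hzU, hz⟩).1
  exact ⟨ρ, fderiv ℝ ρ p, hstrict, hdρ p hpU, hle.antisymm hge, hneg⟩

end Boundary

theorem proposition3_general {n : ℕ} {D : Set (EuclideanSpace ℂ (Fin n))}
    (hD : Bornology.IsBounded D) {p : EuclideanSpace ℂ (Fin n)} {ρ : EuclideanSpace ℂ (Fin n) → ℝ}
    {ρ' : EuclideanSpace ℂ (Fin n) →L[ℝ] ℝ} (hρ : HasStrictFDerivAt ρ ρ' p) (hρ' : ρ' ≠ 0)
    (hρp : ρ p = 0) (hneg : ∀ᶠ z in 𝓝[D] p, ρ z < 0) :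
    Tendsto (fun z => volume (sibonyIndicatrix D z)) (𝓝[D] p) (𝓝 0) := by
  let R := diam D + 1
  have hR : 0 < R := add_pos_of_nonneg_of_pos diam_nonneg one_pos
  have hDR (z) (hz : z ∈ D) : D ⊆ ball z R := fun w hw =>
    (dist_le_diam_of_mem hD hw hz).trans_lt (lt_add_one _)
  let L : EuclideanSpace ℂ (Fin n) →L[ℂ] ℂ := StrongDual.extendRCLike ρ'
  have hL_re (x : EuclideanSpace ℂ (Fin n)) : (L x).re = ρ' x :=
    StrongDual.re_extendRCLike_apply (𝕜 := ℂ) ρ' x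
  have hL : L.restrictScalars ℝ ≠ 0 := fun h =>
    hρ' <| ContinuousLinearMap.ext fun x =>
      (hL_re x).symm.trans (congrArg Complex.re (DFunLike.congr_fun h x))
  refine ENNReal.tendsto_nhds_zero.2 fun ε hε => ?_
  have hvol := tendsto_addHaar_ball_inter_preimage_ball volume hL (3 * R)
  obtain ⟨δ, hδε, hδ⟩ := ((hvol.eventually (ge_mem_nhds hε)).and self_mem_nhdsWithin).exists
  have hη : 0 < δ / (6 * R) := div_pos hδ (by positivity)
  filter_upwards [eventually_exists_forall_fderiv_sub_lt hρ hρp hneg hη hR, self_mem_nhdsWithin]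
    with z ⟨τ, hτ, hτR, hslab⟩ hz
  have hsub := sibonyIndicatrix_subset_slab hz (hDR z hz) hτ hτR L hη fun w hw =>
    (hL_re (w - z)).trans_le (hslab w hw).le
  rw [mul_div_cancel₀ δ (by positivity)] at hsub
  exact (measure_mono hsub).trans hδε

theorem proposition3 {n : ℕ} (D : Set (EuclideanSpace ℂ (Fin n))) (hD_open : IsOpen D)
    (hD_conn : IsConnected D) (hD_bdd : Bornology.IsBounded D)
    (p : EuclideanSpace ℂ (Fin n)) (hp : p ∈ frontier D) (hC1 : HasC1BoundaryNear D p) :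
    Tendsto (fun z => volume (sibonyIndicatrix D z)) (𝓝[D] p) (𝓝 0) := by
  obtain ⟨ρ, ρ', hρ, hρ', hρp, hneg⟩ := hC1.exists_hasStrictFDerivAt hp
  exact proposition3_general hD_bdd hρ hρ' hρp hneg
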